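/- Let $\mathcal X,\mathcal Y$ be finite alphabets and let $P_{XY}$ be any PMF on $\mathcal X\times\mathcal Y$, with marginal $P_X$ and channel $P_{Y|X}$. Let $$d(x,x')=-\log\sum_{y\in\mathcal Y}\sqrt{P_{Y|X}(y\mid x)\,P_{Y|X}(y\mid x')}\in[0,\infty],\qquad \psi_2=\psi_2(P_{XY}):=\min_{Q}\Big\{\tfrac12 D_{\mathrm{KL}}(Q\,\|\,P_X\otimes P_X)+\sum_{x,x'}Q(x,x')\,d(x,x')\Big\},$$ where $Q$ ranges over all PMFs on $\mathcal X^2$ (with the convention $0\cdot\infty=0$); then $0\le\psi_2<\infty$. Let $M\ge1$ and $L\ge0$ be integers, and let $(X_k,Y_k)_{k=1}^{N}$, $N=ML$, be i.i.d. with law $P_{XY}$. Split $X^N$ into $M$ consecutive fragments $\boldsymbol X(1),\dots,\boldsymbol X(M)$ of length $L$. A maximum likelihood (ML) reconstruction algorithm observes the multiset of the fragments and the sequence $Y^N$, and outputs a sequence $\hat X^N$ that maximizes $\mathbb P[Y^N\mid\tilde X^N]$ over all sequences $\tilde X^N=(\boldsymbol X(\pi(1)),\dots,\boldsymbol X(\pi(M)))$,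 $\pi\in S_M$, with ties broken arbitrarily; $\hat{\boldsymbol X}(1),\dots,\hat{\boldsymbol X}(M)$ are the fragments of $\hat X^N$. Let $\Delta:\mathcal X^2\to[0,\infty)$ be a distortion measure with $\Delta(x,x)=0$ for all $x$, extended to fragments by averaging over the $L$ coordinates, and let $\Xi$ be the fraction of indices $i\in\{1,\dots,M\}$ with $\Delta(\boldsymbol X(i),\hat{\boldsymbol X}(i))>0$. Set $\mathsf{FP}(0)=\mathbb P[\Xi>0]$ and $\mathsf{FP}(\xi)=\mathbb P[\Xi\ge\xi]$ for $\xi>0$. (For the Hamming distortion, $\mathsf{FP}(0)=\mathbb P[\hat X^N\ne X^N]$.) Let the fragment length be $L=\beta\log M$, or more generally (for example, $L=\lceil\beta\log M\rceil$) any integer $L\ge\beta\log M$. 1. There is a constant $C$, depending only on $P_{XY}$, such that for all $\beta>1/\psi_2$ (where $1/0=\infty$), all $M\ge1$, all integers $L\ge\beta\log M$, all $\Delta$ and all ML reconstruction algorithms, $$\mathsf{FP}(0)\le C\,M^{2[1-\beta\psi_2]}.$$ 2. For every $\xi>0$ there is a constant $c$, depending only on $P_{XY}$ and $\xi$, such that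 for all $\beta>1/\psi_2$, all $M\ge1$, all integers $L\ge\beta\log M$, all $\Delta$ and all ML reconstruction algorithms, $$\mathsf{FP}(\xi)\le\exp\Big[-M\log M\cdot\xi\Big(\beta\psi_2-1-\frac cM\Big)\Big].$$ -/

import Mathlib

open scoped ENNReal NNReal

noncomputable section

namespace FragmentOrdering

open MeasureTheory InformationTheory

variable {X Y : Type*}

/-- The marginal PMF `P_X` of a joint PMF `P_XY`. -/
def marginal (P : PMF (X × Y)) : PMF X := P.map Prod.fst

/-- The transition kernel `P_{Y|X}(y | x) = P_XY(x, y) / P_X(x)`. It is set to zero at symbols `x`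
with `P_X(x) = 0`, which occur with probability zero. -/
def channel (P : PMF (X × Y)) (x : X) (y : Y) : ℝ :=
  (P (x, y)).toReal / (marginal P x).toReal

/-- The Bhattacharyya coefficient `∑ y, √(P_{Y|X}(y | x) P_{Y|X}(y | x'))`. -/
def bhattCoeff [Fintype Y] (P : PMF (X × Y)) (x x' : X) : ℝ :=
  ∑ y, Real.sqrt (channel P x y * channel P x' y)

/-- The Bhattacharyya distance `d(x, x') = - log ∑ y, √(P_{Y|X}(y | x) P_{Y|X}(y | x'))`, which is
`∞` if the two output distributions have disjoint supports. -/
def bhattDist [Fintype Y] (P : PMF (X × Y)) (x x' : X) : ℝ≥0∞ :=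
  open Classical in
  if bhattCoeff P x x' = 0 then ⊤ else ENNReal.ofReal (-Real.log (bhattCoeff P x x'))

/-- The Bhattacharyya distance of a joint PMF `Q` on pairs of source symbols (the expectation of the
distance under `Q`, with `0 * ∞ = 0`). -/
def bhattDistJoint [Fintype X] [Fintype Y] (P : PMF (X × Y)) (Q : PMF (X × X)) : ℝ≥0∞ :=
  ∑ p : X × X, Q p * bhattDist P p.1 p.2

/-- The objective `½ D_KL(Q ‖ P_X ⊗ P_X) + d(Q)`. -/
def transpositionCost [Fintype X] [Fintype Y] [MeasurableSpace X]
    (P : PMF (X × Y)) (Q : PMF (X × X)) : ℝ≥0∞ :=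
  (1 / 2) * klDiv Q.toMeasure ((marginal P).toMeasure.prod (marginal P).toMeasure)
    + bhattDistJoint P Q

/-- The transposition rate function
`ψ₂(P_XY) = min_Q [½ D_KL(Q ‖ P_X ⊗ P_X) + d(Q)]`, over all PMFs `Q` on `X × X`. -/
def psi2 [Fintype X] [Fintype Y] [MeasurableSpace X] (P : PMF (X × Y)) : ℝ≥0∞ :=
  ⨅ Q : PMF (X × X), transpositionCost P Q

/-- The value `ψ₂` is finite, so that nothing is lost by reading it as a real number. -/
theorem psi2_ne_top [Fintype X] [Fintype Y] [MeasurableSpace X] [MeasurableSingletonClass X]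
    (P : PMF (X × Y)) : psi2 P ≠ ⊤ := by
  obtain ⟨x, hx⟩ := (marginal P).support_nonempty
  have hx0 : marginal P x ≠ 0 := (PMF.mem_support_iff _ _).1 hx
  have hxt : marginal P x ≠ ⊤ := PMF.apply_ne_top _ _
  have hsum : ∑ y, P (x, y) = marginal P x := by
    classical
    rw [marginal, PMF.map_apply, tsum_fintype, Fintype.sum_prod_type]
    rw [Finset.sum_eq_single x]
    · simp
    · intro b _ hb
      simp [Ne.symm hb]
    · simp
  have hB : bhattCoeff P x x = 1 := by
    have h0 : ∀ y, 0 ≤ channel P x y := fun y => by unfold channel; positivity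
    have h1 : ∀ y, Real.sqrt (channel P x y * channel P x y) = channel P x y :=
      fun y => Real.sqrt_mul_self (h0 y)
    simp only [bhattCoeff, h1]
    simp only [channel]
    rw [← Finset.sum_div, ← ENNReal.toReal_sum (fun y _ => PMF.apply_ne_top _ _), hsum]
    exact div_self (ENNReal.toReal_ne_zero.2 ⟨hx0, hxt⟩)
  have hd : bhattDist P x x = 0 := by simp [bhattDist, hB]
  refine ne_top_of_le_ne_top ?_ (iInf_le _ (PMF.pure (x, x)))
  unfold transpositionCost
  refine ENNReal.add_ne_top.2 ⟨ENNReal.mul_ne_top (by simp) ?_, ?_⟩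
  · refine klDiv_ne_top ?_ Integrable.of_finite
    intro s hs
    rw [PMF.toMeasure_pure, Measure.dirac_apply' _ s.toFinite.measurableSet,
      Set.indicator_of_notMem]
    intro hmem
    have h2 := measure_mono_null (Set.singleton_subset_iff.2 hmem) hs
    rw [← Set.singleton_prod_singleton, Measure.prod_prod,
      PMF.toMeasure_apply_singleton _ _ (measurableSet_singleton x)] at h2
    simp [hx0] at h2
  · have : bhattDistJoint P (PMF.pure (x, x)) = 0 := by
      refine Finset.sum_eq_zero fun p _ => ?_
      by_cases hp : p = (x, x)
      · subst hp; simp [hd]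
      · simp [PMF.pure_apply, hp]
    simp [this]

/-- The multiset of the `M` fragments (each of length `L`) of a sequence. Sequences of length
`N = M L` are indexed by the fragment and the position inside the fragment. -/
def fragments {L M : ℕ} (x : Fin M → Fin L → X) : Multiset (Fin L → X) :=
  Finset.univ.val.map x

/-- All sequences that can be reconstructed by ordering the fragments of `x`. -/
def reorderings {L M : ℕ} (x : Fin M → Fin L → X) : Set (Fin M → Fin L → X) :=
  Set.range fun π : Equiv.Perm (Fin M) => fun i => x (π i)

/-- The likelihood `P[Y^N = y | X^N = x]` of the memoryless channel. -/
def likelihood {L M : ℕ} (P : PMF (X × Y)) (x : Fin M → Fin L → X) (y : Fin M → Fin L → Y) : ℝ :=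
  ∏ i, ∏ j, channel P (x i j) (y i j)

/-- A maximum likelihood reconstruction algorithm: from the multiset of fragments and the reference
sequence, it outputs an ordering of the fragments of largest likelihood. Ties are broken in an
arbitrary way. -/
def IsMLReconstruction {L M : ℕ} (P : PMF (X × Y))
    (rec' : Multiset (Fin L → X) → (Fin M → Fin L → Y) → (Fin M → Fin L → X)) : Prop :=
  ∀ (x : Fin M → Fin L → X) (y : Fin M → Fin L → Y),
    rec' (fragments x) y ∈ reorderings x ∧
      ∀ x' ∈ reorderings x, likelihood P x' y ≤ likelihood P (rec' (fragments x) y) y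

/-- The additive extension of a distortion measure to fragments, `(1/L) ∑ j, Δ(u j, v j)`. -/
def fragDistortion {L : ℕ} (Δ : X → X → ℝ≥0) (u v : Fin L → X) : ℝ :=
  (1 / (L : ℝ)) * ∑ j, (Δ (u j) (v j) : ℝ)

/-- The relative number of fragments that are reconstructed with nonzero distortion. -/
def failureFraction {L M : ℕ} (Δ : X → X → ℝ≥0) (x xhat : Fin M → Fin L → X) : ℝ :=
  (1 / (M : ℝ)) * (Nat.card {i : Fin M // 0 < fragDistortion Δ (x i) (xhat i)} : ℝ)

/-- The failure probability `FP(ξ)` at zero distortion, for `(X^N, Y^N)` drawn i.i.d. from `P`.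
For `ξ > 0` the failure event is that the fraction of failed fragments is at least `ξ`, and for
`ξ = 0` that at least one fragment failed. -/
def failureProb {L M : ℕ} [MeasurableSpace X] [MeasurableSpace Y] (P : PMF (X × Y))
    (Δ : X → X → ℝ≥0)
    (rec' : Multiset (Fin L → X) → (Fin M → Fin L → Y) → (Fin M → Fin L → X)) (ξ : ℝ) : ℝ :=
  (Measure.pi fun _ : Fin M => Measure.pi fun _ : Fin L => P.toMeasure).real
    {z : Fin M → Fin L → X × Y |
      let x := fun i j => (z i j).1
      let y := fun i j => (z i j).2
      let f := failureFraction Δ x (rec' (fragments x) y)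
      0 < f ∧ ξ ≤ f}

end FragmentOrdering

end

namespace FragmentOrdering

/-! The proof is a union bound over permutations `π` with a Bhattacharyya estimate for each. If the
ordering `π` is at least as likely as the true one, the true likelihood is at most the geometric
mean of the two. Summing this over all outcomes factors over the `L` positions, and each position
contributes `∑ x, ∏ i, A (x i) (x (π i))`, where `A` is the matrix `overlap P`.

Such a sum is a product over the cycles of `π` of traces of powers of `A`. A fixed point gives `tr A
= 1`; a cycle of length `l ≥ 2` gives at most `F ^ l`, with `F = frob A`, by Cauchy-Schwarz
(`sum_prod_perm_le`). Hence `π` succeeds with probability at most `F ^ (L f)`, where `f` is the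
number of moved fragments (`measureReal_likelihood_le`).

The Gibbs variational principle identifies `ψ₂` with `-log F`. Only `F ≤ exp (-ψ₂)` is needed, and
testing the infimum at the PMF proportional to the squared entries of `A` gives it
(`frob_overlap_le_exp_neg_psi2`). With at most `M ^ f` permutations moving `f` fragments and `L ≥ β
log M`, the failure probability is at most a geometric sum of `r ^ f`, `r = M ^ (1 - β ψ₂)`. It
starts at `f = 2` for perfect reconstruction, since no permutation moves exactly one point, and at
`⌈ξ M⌉` for `ξ > 0`. -/

/-! ### Traces and Frobenius norms along the cycles of a permutation. -/

/-- The Frobenius norm of a real matrix. -/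
noncomputable def frob {X : Type*} [Fintype X] (A : Matrix X X ℝ) : ℝ :=
  Real.sqrt (∑ a, ∑ b, A a b ^ 2)

lemma frob_nonneg {X : Type*} [Fintype X] (A : Matrix X X ℝ) : 0 ≤ frob A := Real.sqrt_nonneg _

lemma frob_sq {X : Type*} [Fintype X] (A : Matrix X X ℝ) : frob A ^ 2 = ∑ a, ∑ b, A a b ^ 2 :=
  Real.sq_sqrt (Finset.sum_nonneg fun _ _ => Finset.sum_nonneg fun _ _ => sq_nonneg _)

lemma trace_mul_le_frob {X : Type*} [Fintype X] (A B : Matrix X X ℝ) :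
    (A * B).trace ≤ frob A * frob B := by
  refine le_of_sq_le_sq ?_ (mul_nonneg (frob_nonneg A) (frob_nonneg B))
  rw [mul_pow, frob_sq, frob_sq]
  have h := Finset.sum_mul_sq_le_sq_mul_sq (Finset.univ : Finset (X × X))
    (fun p => A p.1 p.2) (fun p => B p.2 p.1)
  simp only [Fintype.sum_prod_type] at h
  rw [Finset.sum_comm (f := fun x y => B y x ^ 2)] at h
  simpa [Matrix.trace, Matrix.mul_apply] using h

lemma frob_mul_le {X : Type*} [Fintype X] (A B : Matrix X X ℝ) :
    frob (A * B) ≤ frob A * frob B := by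
  refine le_of_sq_le_sq ?_ (mul_nonneg (frob_nonneg A) (frob_nonneg B))
  rw [mul_pow, frob_sq, frob_sq, frob_sq, Finset.sum_comm (f := fun a b => B a b ^ 2),
    Finset.sum_mul_sum]
  refine Finset.sum_le_sum fun a _ => Finset.sum_le_sum fun b _ => ?_
  rw [Matrix.mul_apply]
  exact Finset.sum_mul_sq_le_sq_mul_sq _ _ _

/-- The factor of the index `i` in the cycle bound: a trace at a fixed point, a Frobenius norm at
a moved point. -/
noncomputable def cycleWeight {X : Type*} [Fintype X] {n : ℕ} (A : Fin n → Matrix X X ℝ)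
    (π : Equiv.Perm (Fin n)) (i : Fin n) : ℝ :=
  if π i = i then (A i).trace else frob (A i)

lemma cycleWeight_nonneg {X : Type*} [Fintype X] {n : ℕ} {A : Fin n → Matrix X X ℝ}
    (hA : ∀ i a b, 0 ≤ A i a b) (π : Equiv.Perm (Fin n)) (i : Fin n) :
    0 ≤ cycleWeight A π i := by
  unfold cycleWeight
  split_ifs
  · exact Finset.sum_nonneg fun a _ => hA i a a
  · exact frob_nonneg _

lemma sum_fin_succ_fun {X : Type*} [Fintype X] {n : ℕ} (f : (Fin (n + 1) → X) → ℝ) :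
    ∑ x, f x = ∑ x : Fin n → X, ∑ a, f (Fin.cons a x) := by
  rw [← (Fin.consEquiv fun _ : Fin (n + 1) => X).sum_comp, Fintype.sum_prod_type,
    Finset.sum_comm]
  rfl

/-- A Cauchy-Schwarz inequality along the cycles of a permutation. -/
theorem sum_prod_perm_le {X : Type*} [Fintype X] {n : ℕ} (A : Fin n → Matrix X X ℝ)
    (hA : ∀ i a b, 0 ≤ A i a b) (π : Equiv.Perm (Fin n)) :
    ∑ x : Fin n → X, ∏ i, A i (x i) (x (π i)) ≤ ∏ i, cycleWeight A π i := by
  induction n with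
  | zero => simp
  | succ n ih =>
    -- Index `0` is removed from its cycle: `p` is its image under `π`, and `σ` is the permutation
    -- left on the other indices once `0` is bypassed.
    obtain ⟨⟨p, σ⟩, rfl⟩ := Equiv.Perm.decomposeFin.symm.surjective π
    rw [sum_fin_succ_fun, Fin.prod_univ_succ]
    simp only [Fin.prod_univ_succ, Fin.cons_zero, Fin.cons_succ,
      Equiv.Perm.decomposeFin_symm_apply_zero, Equiv.Perm.decomposeFin_symm_apply_succ]
    induction p using Fin.cases with
    | zero =>
      simp only [Equiv.swap_self, Equiv.refl_apply, Fin.cons_zero, Fin.cons_succ]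
      have hw : ∀ i : Fin n, cycleWeight A (Equiv.Perm.decomposeFin.symm (0, σ)) i.succ
          = cycleWeight (fun i => A i.succ) σ i := fun i => by
        simp [cycleWeight]
      have h0 : cycleWeight A (Equiv.Perm.decomposeFin.symm (0, σ)) 0 = (A 0).trace := by
        simp [cycleWeight]
      simp only [hw, h0, ← Finset.sum_mul]
      rw [← Finset.mul_sum]
      exact mul_le_mul_of_nonneg_left (ih _ (fun i => hA i.succ) σ)
        (Finset.sum_nonneg fun a _ => hA 0 a a)
    | succ j =>
      set i₀ := σ.symm j with hi₀
      have hσ : ∀ i, σ i = j ↔ i = i₀ := fun i => by rw [hi₀, Equiv.eq_symm_apply]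
      -- In `π` the cycle runs `i₀ → 0 → j`; in `σ` it runs `i₀ → j`. Summing out the variable at
      -- `0` merges the two adjacent factors into a matrix product at `i₀`.
      let A' : Fin n → Matrix X X ℝ := fun i => if i = i₀ then A i₀.succ * A 0 else A i.succ
      have hswap : ∀ i, Equiv.swap 0 j.succ (σ i).succ = if i = i₀ then 0 else (σ i).succ := by
        intro i
        split_ifs with h
        · rw [(hσ i).2 h, Equiv.swap_apply_right]
        · exact Equiv.swap_apply_of_ne_of_ne (Fin.succ_ne_zero _)
            fun h' => h ((hσ i).1 (Fin.succ_injective _ h'))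
      have hA' : ∀ i a b, 0 ≤ A' i a b := by
        intro i a b
        simp only [A']
        split_ifs
        · rw [Matrix.mul_apply]
          exact Finset.sum_nonneg fun c _ => mul_nonneg (hA _ _ _) (hA _ _ _)
        · exact hA _ _ _
      have hsum : ∀ x : Fin n → X, ∑ a, A 0 a (x j) * ∏ i : Fin n, A i.succ (x i)
          ((Fin.cons a x : Fin (n + 1) → X) (Equiv.swap 0 j.succ (σ i).succ))
          = ∏ i, A' i (x i) (x (σ i)) := by
        intro x
        rw [← Finset.mul_prod_erase _ _ (Finset.mem_univ i₀)]
        have h1 : A' i₀ (x i₀) (x (σ i₀)) = ∑ a, A i₀.succ (x i₀) a * A 0 a (x j) := by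
          simp only [A', if_true, Matrix.mul_apply, (hσ i₀).2 rfl]
        rw [h1, Finset.sum_mul]
        refine Finset.sum_congr rfl fun a _ => ?_
        rw [← Finset.mul_prod_erase _ _ (Finset.mem_univ i₀), hswap, if_pos rfl, Fin.cons_zero,
          ← mul_assoc, mul_comm (A 0 a (x j))]
        congr 1
        refine Finset.prod_congr rfl fun i hi => ?_
        have hne := Finset.ne_of_mem_erase hi
        rw [hswap, if_neg hne, Fin.cons_succ]
        simp only [A', if_neg hne]
      refine (Finset.sum_le_sum fun x _ => (hsum x).le).trans ((ih A' hA' σ).trans ?_)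
      set π := Equiv.Perm.decomposeFin.symm (j.succ, σ) with hπ
      have hπs : ∀ i : Fin n, π i.succ = if i = i₀ then 0 else (σ i).succ := fun i => by
        rw [hπ, Equiv.Perm.decomposeFin_symm_apply_succ, hswap]
      have hw0 : cycleWeight A π 0 = frob (A 0) := by
        simp [cycleWeight, hπ]
      rw [hw0, ← Finset.mul_prod_erase _ _ (Finset.mem_univ i₀),
        ← Finset.mul_prod_erase _ (fun i : Fin n => cycleWeight A π i.succ) (Finset.mem_univ i₀),
        ← mul_assoc]
      have hrest : ∏ i ∈ Finset.univ.erase i₀, cycleWeight A' σ i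
          = ∏ i ∈ Finset.univ.erase i₀, cycleWeight A π i.succ := by
        refine Finset.prod_congr rfl fun i hi => ?_
        have hne := Finset.ne_of_mem_erase hi
        simp [cycleWeight, hπs, hne, A']
      rw [hrest]
      refine mul_le_mul_of_nonneg_right ?_
        (Finset.prod_nonneg fun i _ => cycleWeight_nonneg hA π i.succ)
      have hw1 : cycleWeight A π i₀.succ = frob (A i₀.succ) := by
        simp [cycleWeight, hπs, (Fin.succ_ne_zero _).symm]
      rw [hw1, mul_comm]
      simp only [cycleWeight, A', if_true]
      -- If `σ` fixes `i₀`, then `0` and `i₀` form a 2-cycle of `π` and the merged factor is a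
      -- trace. Otherwise it is a Frobenius norm, which is submultiplicative.
      split_ifs
      · exact trace_mul_le_frob _ _
      · exact frob_mul_le _ _

/-! ### Counting permutations by the number of moved points. -/

/-- At most `n ^ f` permutations of `n` letters move exactly `f` letters. -/
theorem card_perm_card_support_le (n f : ℕ) :
    (Finset.univ.filter fun π : Equiv.Perm (Fin n) => π.support.card = f).card ≤ n ^ f := by
  classical
  have hsub : (Finset.univ.filter fun π : Equiv.Perm (Fin n) => π.support.card = f) ⊆
      (Finset.powersetCard f (Finset.univ : Finset (Fin n))).biUnion fun S =>
        Finset.univ.filter fun π : Equiv.Perm (Fin n) => ∀ a, ¬ a ∈ S → π a = a := by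
    intro π hπ
    simp only [Finset.mem_filter, Finset.mem_univ, true_and, Finset.mem_biUnion,
      Finset.mem_powersetCard] at hπ ⊢
    exact ⟨π.support, ⟨Finset.subset_univ _, hπ⟩, fun a ha => Equiv.Perm.notMem_support.1 ha⟩
  refine (Finset.card_le_card hsub).trans ((Finset.card_biUnion_le_card_mul _ _ f.factorial
    fun S hS => ?_).trans ?_)
  · rw [← Fintype.card_subtype, ← Fintype.card_congr (Equiv.Perm.subtypeEquivSubtypePerm (· ∈ S)),
      Fintype.card_perm]
    simp [(Finset.mem_powersetCard.1 hS).2]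
  · rw [Finset.card_powersetCard, Finset.card_univ, Fintype.card_fin, mul_comm,
      ← Nat.descFactorial_eq_factorial_mul_choose]
    exact Nat.descFactorial_le_pow n f

lemma sum_perm_pow_card_support_le (n k : ℕ) {q : ℝ} (hq : 0 ≤ q) :
    ∑ π : Equiv.Perm (Fin n) with k ≤ π.support.card, q ^ π.support.card
      ≤ ∑ f ∈ Finset.Ico k (n + 1), ((n : ℝ) * q) ^ f := by
  rw [← Finset.sum_fiberwise_of_maps_to (t := Finset.Ico k (n + 1))
    (g := fun π : Equiv.Perm (Fin n) => π.support.card)]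
  · refine Finset.sum_le_sum fun f _ => ?_
    rw [Finset.sum_congr rfl (g := fun _ => q ^ f)
      fun π hπ => by rw [(Finset.mem_filter.1 hπ).2], Finset.sum_const, nsmul_eq_mul, mul_pow]
    refine mul_le_mul_of_nonneg_right ?_ (pow_nonneg hq f)
    have h := (Finset.card_le_card (Finset.filter_subset_filter
      (fun π : Equiv.Perm (Fin n) => π.support.card = f) (Finset.filter_subset
        (fun π : Equiv.Perm (Fin n) => k ≤ π.support.card) Finset.univ))).trans
        (card_perm_card_support_le n f)
    exact_mod_cast h
  · intro π hπ
    have h := Finset.card_le_univ π.support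
    rw [Fintype.card_fin] at h
    exact Finset.mem_Ico.2 ⟨(Finset.mem_filter.1 hπ).2, by omega⟩

/-! ### The channel and the Bhattacharyya coefficient. -/

open MeasureTheory InformationTheory

variable {X Y : Type*}

lemma marginal_eq_sum [Fintype X] [Fintype Y] (P : PMF (X × Y)) (x : X) :
    marginal P x = ∑ y, P (x, y) := by
  classical
  rw [marginal, PMF.map_apply, tsum_fintype, Fintype.sum_prod_type, Finset.sum_eq_single x]
  · simp
  · intro b _ hb
    simp [Ne.symm hb]
  · simp

lemma sum_toReal_eq_marginal [Fintype X] [Fintype Y] (P : PMF (X × Y)) (x : X) :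
    ∑ y, (P (x, y)).toReal = (marginal P x).toReal := by
  rw [marginal_eq_sum, ENNReal.toReal_sum fun y _ => PMF.apply_ne_top _ _]

lemma sum_pmf_toReal {Z : Type*} [Fintype Z] (Q : PMF Z) : ∑ z, (Q z).toReal = 1 := by
  rw [← ENNReal.toReal_sum fun y _ => PMF.apply_ne_top _ _, ← tsum_fintype (L := .unconditional _),
    PMF.tsum_coe, ENNReal.toReal_one]

lemma channel_nonneg (P : PMF (X × Y)) (x : X) (y : Y) : 0 ≤ channel P x y := by
  unfold channel
  positivity

lemma marginal_mul_channel [Fintype X] [Fintype Y] (P : PMF (X × Y)) (x : X) (y : Y) :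
    (marginal P x).toReal * channel P x y = (P (x, y)).toReal := by
  unfold channel
  by_cases h : (marginal P x).toReal = 0
  · have h1 : (P (x, y)).toReal ≤ (marginal P x).toReal := by
      rw [← sum_toReal_eq_marginal]
      exact Finset.single_le_sum (f := fun y => (P (x, y)).toReal)
        (fun y _ => ENNReal.toReal_nonneg) (Finset.mem_univ y)
    rw [h, zero_mul]
    exact le_antisymm ENNReal.toReal_nonneg (h ▸ h1)
  · field_simp

/-- The sum is `1` on the support of `P_X` and `0` off it, because division by zero gives zero. -/
lemma sum_channel_le_one [Fintype X] [Fintype Y] (P : PMF (X × Y)) (x : X) :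
    ∑ y, channel P x y ≤ 1 := by
  unfold channel
  rw [← Finset.sum_div, sum_toReal_eq_marginal]
  exact div_self_le_one _

lemma bhattCoeff_nonneg [Fintype Y] (P : PMF (X × Y)) (x x' : X) : 0 ≤ bhattCoeff P x x' :=
  Finset.sum_nonneg fun _ _ => Real.sqrt_nonneg _

lemma bhattCoeff_le_one [Fintype X] [Fintype Y] (P : PMF (X × Y)) (x x' : X) :
    bhattCoeff P x x' ≤ 1 := by
  have h : ∀ y, Real.sqrt (channel P x y * channel P x' y)
      ≤ (channel P x y + channel P x' y) / 2 := fun y => by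
    rw [Real.sqrt_le_left (by linarith [channel_nonneg P x y, channel_nonneg P x' y])]
    nlinarith [sq_nonneg (channel P x y - channel P x' y)]
  calc bhattCoeff P x x' ≤ ∑ y, (channel P x y + channel P x' y) / 2 :=
        Finset.sum_le_sum fun y _ => h y
    _ = (∑ y, channel P x y + ∑ y, channel P x' y) / 2 := by
        rw [← Finset.sum_div, Finset.sum_add_distrib]
    _ ≤ 1 := by linarith [sum_channel_le_one P x, sum_channel_le_one P x']

lemma bhattCoeff_self [Fintype Y] (P : PMF (X × Y)) (x : X) :
    bhattCoeff P x x = ∑ y, channel P x y :=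
  Finset.sum_congr rfl fun y _ => Real.sqrt_mul_self (channel_nonneg P x y)

lemma bhattDist_eq_ofReal [Fintype X] [Fintype Y] (P : PMF (X × Y)) {x x' : X}
    (h : bhattCoeff P x x' ≠ 0) :
    bhattDist P x x' = ENNReal.ofReal (-Real.log (bhattCoeff P x x')) := by
  simp [bhattDist, h]

/-! ### The overlap matrix and the variational bound for `ψ₂`. -/

/-- The overlap matrix `√(P_X(x) P_X(x')) ∑ y, √(P_{Y|X}(y | x) P_{Y|X}(y | x'))`. -/
noncomputable def overlap [Fintype Y] (P : PMF (X × Y)) : Matrix X X ℝ :=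
  fun x x' => Real.sqrt ((marginal P x).toReal * (marginal P x').toReal) * bhattCoeff P x x'

lemma overlap_nonneg [Fintype Y] (P : PMF (X × Y)) (x x' : X) : 0 ≤ overlap P x x' :=
  mul_nonneg (Real.sqrt_nonneg _) (bhattCoeff_nonneg P x x')

lemma overlap_self [Fintype X] [Fintype Y] (P : PMF (X × Y)) (x : X) :
    overlap P x x = (marginal P x).toReal := by
  rw [overlap, Real.sqrt_mul_self ENNReal.toReal_nonneg, bhattCoeff_self, Finset.mul_sum]
  simp only [marginal_mul_channel, sum_toReal_eq_marginal]

lemma trace_overlap [Fintype X] [Fintype Y] (P : PMF (X × Y)) : (overlap P).trace = 1 := by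
  simp only [Matrix.trace, Matrix.diag_apply, overlap_self]
  exact sum_pmf_toReal _

lemma overlap_sq [Fintype Y] (P : PMF (X × Y)) (x x' : X) :
    overlap P x x' ^ 2
      = (marginal P x).toReal * (marginal P x').toReal * bhattCoeff P x x' ^ 2 := by
  rw [overlap, mul_pow, Real.sq_sqrt (by positivity)]

lemma frob_overlap_pos [Fintype X] [Fintype Y] (P : PMF (X × Y)) : 0 < frob (overlap P) := by
  obtain ⟨x, hx⟩ := (marginal P).support_nonempty
  have hx0 : 0 < (marginal P x).toReal :=
    ENNReal.toReal_pos ((PMF.mem_support_iff _ _).1 hx) (PMF.apply_ne_top _ _)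
  refine Real.sqrt_pos.2 (lt_of_lt_of_le (pow_pos hx0 2) ?_)
  rw [← overlap_self]
  exact (Finset.single_le_sum (f := fun b => overlap P x b ^ 2)
    (fun b _ => sq_nonneg _) (Finset.mem_univ x)).trans
    (Finset.single_le_sum (f := fun a => ∑ b, overlap P a b ^ 2)
      (fun a _ => Finset.sum_nonneg fun b _ => sq_nonneg _) (Finset.mem_univ x))

/-- The PMF on pairs proportional to the squared entries of the overlap matrix. -/
noncomputable def tiltedPMF [Fintype X] [Fintype Y] (P : PMF (X × Y)) : PMF (X × X) :=
  PMF.ofFintype (fun z => ENNReal.ofReal (overlap P z.1 z.2 ^ 2 / frob (overlap P) ^ 2)) <| by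
    rw [← ENNReal.ofReal_sum_of_nonneg fun z _ => by positivity, ← Finset.sum_div,
      (Fintype.sum_prod_type _).trans (frob_sq (overlap P)).symm,
      div_self (pow_pos (frob_overlap_pos P) 2).ne',
      ENNReal.ofReal_one]

lemma tiltedPMF_apply [Fintype X] [Fintype Y] (P : PMF (X × Y)) (z : X × X) :
    tiltedPMF P z = ENNReal.ofReal (overlap P z.1 z.2 ^ 2 / frob (overlap P) ^ 2) :=
  PMF.ofFintype_apply _ z

lemma toMeasure_tiltedPMF [Fintype X] [Fintype Y] [MeasurableSpace X] [MeasurableSingletonClass X]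
    (P : PMF (X × Y)) :
    (tiltedPMF P).toMeasure = ((marginal P).toMeasure.prod (marginal P).toMeasure).withDensity
      fun z => ENNReal.ofReal (bhattCoeff P z.1 z.2 ^ 2 / frob (overlap P) ^ 2) := by
  refine Measure.ext_of_singleton fun z => ?_
  rw [withDensity_apply _ (measurableSet_singleton z), lintegral_singleton,
    PMF.toMeasure_apply_singleton _ _ (measurableSet_singleton z), tiltedPMF_apply,
    ← Set.singleton_prod_singleton, Measure.prod_prod,
    PMF.toMeasure_apply_singleton _ _ (measurableSet_singleton _),
    PMF.toMeasure_apply_singleton _ _ (measurableSet_singleton _), overlap_sq,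
    ← ENNReal.ofReal_toReal (PMF.apply_ne_top (marginal P) z.1),
    ← ENNReal.ofReal_toReal (PMF.apply_ne_top (marginal P) z.2),
    ← ENNReal.ofReal_mul ENNReal.toReal_nonneg, ← ENNReal.ofReal_mul (by positivity)]
  congr 1
  rw [ENNReal.toReal_ofReal ENNReal.toReal_nonneg, ENNReal.toReal_ofReal ENNReal.toReal_nonneg]
  ring

lemma klDiv_tiltedPMF [Fintype X] [Fintype Y] [MeasurableSpace X] [MeasurableSingletonClass X]
    (P : PMF (X × Y)) :
    klDiv (tiltedPMF P).toMeasure ((marginal P).toMeasure.prod (marginal P).toMeasure) ≠ ⊤ ∧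
    (klDiv (tiltedPMF P).toMeasure ((marginal P).toMeasure.prod (marginal P).toMeasure)).toReal
      = ∑ z, (tiltedPMF P z).toReal *
          Real.log (bhattCoeff P z.1 z.2 ^ 2 / frob (overlap P) ^ 2) := by
  set ν := (marginal P).toMeasure.prod (marginal P).toMeasure
  have hac : (tiltedPMF P).toMeasure ≪ ν := by
    rw [toMeasure_tiltedPMF]
    exact withDensity_absolutelyContinuous _ _
  refine ⟨klDiv_ne_top hac Integrable.of_finite, ?_⟩
  have hllr : llr (tiltedPMF P).toMeasure ν =ᵐ[(tiltedPMF P).toMeasure]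
      fun z => Real.log (bhattCoeff P z.1 z.2 ^ 2 / frob (overlap P) ^ 2) := by
    have h := Measure.rnDeriv_withDensity ν (f := fun z : X × X =>
      ENNReal.ofReal (bhattCoeff P z.1 z.2 ^ 2 / frob (overlap P) ^ 2)) (measurable_of_finite _)
    rw [← toMeasure_tiltedPMF] at h
    filter_upwards [hac.ae_le h] with z hz
    rw [llr_def]
    simp only [hz]
    rw [ENNReal.toReal_ofReal (by positivity)]
  -- Both measures have mass one, so the mass correction in `klDiv` vanishes and only the integral
  -- of the log-likelihood ratio remains.
  rw [toReal_klDiv_of_measure_eq hac (by simp [ν]),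
    integral_congr_ae hllr, integral_fintype Integrable.of_finite]
  simp [Measure.real, PMF.toMeasure_apply_singleton _ _ (measurableSet_singleton _)]

lemma bhattDistJoint_tiltedPMF [Fintype X] [Fintype Y] (P : PMF (X × Y)) :
    bhattDistJoint P (tiltedPMF P)
      = ENNReal.ofReal (∑ z : X × X, (tiltedPMF P z).toReal *
          -Real.log (bhattCoeff P z.1 z.2)) := by
  have hlog : ∀ z : X × X, 0 ≤ -Real.log (bhattCoeff P z.1 z.2) := fun z =>
    neg_nonneg.2 (Real.log_nonpos (bhattCoeff_nonneg P _ _) (bhattCoeff_le_one P _ _))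
  rw [bhattDistJoint, ENNReal.ofReal_sum_of_nonneg fun z _ =>
    mul_nonneg ENNReal.toReal_nonneg (hlog z)]
  refine Finset.sum_congr rfl fun z _ => ?_
  rw [ENNReal.ofReal_mul ENNReal.toReal_nonneg, ENNReal.ofReal_toReal (PMF.apply_ne_top _ _)]
  -- Where the distance is infinite the tilted PMF has no mass, so `0 * ∞ = 0` agrees with the value
  -- `Real.log 0 = 0`.
  by_cases h : bhattCoeff P z.1 z.2 = 0
  · have h0 : tiltedPMF P z = 0 := by simp [tiltedPMF_apply, overlap, h]
    simp [h0]
  · rw [bhattDist_eq_ofReal P h]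

/-- One half of the Gibbs variational principle for `ψ₂`: its value is at most
`-log ‖overlap P‖`. -/
theorem frob_overlap_le_exp_neg_psi2 [Fintype X] [Fintype Y] [MeasurableSpace X]
    [MeasurableSingletonClass X] (P : PMF (X × Y)) :
    frob (overlap P) ≤ Real.exp (-(psi2 P).toReal) := by
  have hF := frob_overlap_pos P
  set F := frob (overlap P) with hFdef
  set K := ∑ z, (tiltedPMF P z).toReal * Real.log (bhattCoeff P z.1 z.2 ^ 2 / F ^ 2) with hK
  set D := ∑ z : X × X, (tiltedPMF P z).toReal * -Real.log (bhattCoeff P z.1 z.2) with hD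
  have hD0 : 0 ≤ D := Finset.sum_nonneg fun z _ => mul_nonneg ENNReal.toReal_nonneg <|
    neg_nonneg.2 (Real.log_nonpos (bhattCoeff_nonneg P _ _) (bhattCoeff_le_one P _ _))
  -- Pointwise `½ log (B² / F²) - log B = -log F`: the tilt is chosen so that the cost is constant
  -- on its support.
  have hKD : K / 2 + D = -Real.log F := by
    have h : ∀ z : X × X, (tiltedPMF P z).toReal * Real.log (bhattCoeff P z.1 z.2 ^ 2 / F ^ 2) / 2
        + (tiltedPMF P z).toReal * -Real.log (bhattCoeff P z.1 z.2)
        = (tiltedPMF P z).toReal * -Real.log F := by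
      intro z
      by_cases h : bhattCoeff P z.1 z.2 = 0
      · have h0 : tiltedPMF P z = 0 := by simp [tiltedPMF_apply, overlap, h]
        simp [h0]
      · rw [Real.log_div (pow_ne_zero 2 h) (pow_ne_zero 2 hF.ne'), Real.log_pow, Real.log_pow]
        push_cast
        ring
    rw [hK, hD, Finset.sum_div, ← Finset.sum_add_distrib, Finset.sum_congr rfl fun z _ => h z,
      ← Finset.sum_mul, sum_pmf_toReal, one_mul]
  obtain ⟨hne, hkl⟩ := klDiv_tiltedPMF P
  rw [← hFdef, ← hK] at hkl
  have hK0 : 0 ≤ K := hkl ▸ ENNReal.toReal_nonneg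
  have hle : psi2 P ≤ ENNReal.ofReal (-Real.log F) := by
    refine (iInf_le _ (tiltedPMF P)).trans (le_of_eq ?_)
    rw [transpositionCost, ← ENNReal.ofReal_toReal hne, hkl, bhattDistJoint_tiltedPMF, ← hKD,
      ENNReal.ofReal_add (by positivity) hD0, div_eq_inv_mul, ENNReal.ofReal_mul (by norm_num)]
    simp [hD]
  have hle' : (psi2 P).toReal ≤ -Real.log F := by
    have := ENNReal.toReal_mono ENNReal.ofReal_ne_top hle
    rwa [ENNReal.toReal_ofReal (hKD ▸ by positivity)] at this
  calc F = Real.exp (Real.log F) := (Real.exp_log hF).symm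
    _ ≤ _ := Real.exp_le_exp.2 (by linarith)

/-! ### The probability that one given ordering beats the truth. -/

lemma likelihood_nonneg {L M : ℕ} (P : PMF (X × Y)) (x : Fin M → Fin L → X)
    (y : Fin M → Fin L → Y) : 0 ≤ likelihood P x y :=
  Finset.prod_nonneg fun _ _ => Finset.prod_nonneg fun _ _ => channel_nonneg P _ _

/-- The Bhattacharyya bound for the comparison of two likelihoods. -/
lemma likelihood_le_prod_sqrt {L M : ℕ} (P : PMF (X × Y)) {x x' : Fin M → Fin L → X}
    {y : Fin M → Fin L → Y} (h : likelihood P x y ≤ likelihood P x' y) :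
    likelihood P x y
      ≤ ∏ i, ∏ j, Real.sqrt (channel P (x i j) (y i j) * channel P (x' i j) (y i j)) := by
  refine le_of_sq_le_sq ?_ (Finset.prod_nonneg fun _ _ => Finset.prod_nonneg fun _ _ =>
    Real.sqrt_nonneg _)
  have h1 : (∏ i, ∏ j, Real.sqrt (channel P (x i j) (y i j) * channel P (x' i j) (y i j))) ^ 2
      = likelihood P x y * likelihood P x' y := by
    simp only [← Finset.prod_pow, likelihood, ← Finset.prod_mul_distrib]
    exact Finset.prod_congr rfl fun i _ => Finset.prod_congr rfl fun j _ =>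
      Real.sq_sqrt (mul_nonneg (channel_nonneg P _ _) (channel_nonneg P _ _))
  rw [h1, sq]
  exact mul_le_mul_of_nonneg_left h (likelihood_nonneg P x y)

lemma sum_prod_eq_sum_prod_overlap [Fintype X] [Fintype Y] {M : ℕ} (P : PMF (X × Y))
    (π : Equiv.Perm (Fin M)) :
    ∑ z : Fin M → X × Y, ∏ i, (marginal P (z i).1).toReal *
        Real.sqrt (channel P (z i).1 (z i).2 * channel P (z (π i)).1 (z i).2)
      = ∑ x : Fin M → X, ∏ i, overlap P (x i) (x (π i)) := by
  classical
  rw [← (Equiv.arrowProdEquivProdArrow (Fin M) (fun _ => X) (fun _ => Y)).symm.sum_comp,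
    Fintype.sum_prod_type]
  refine Finset.sum_congr rfl fun x _ => ?_
  -- The product of the marginals is invariant under `π`, so it equals its geometric mean with its
  -- permuted copy; this makes each factor symmetric, as in `overlap`.
  have hp : ∏ i, (marginal P (x i)).toReal
      = ∏ i, Real.sqrt ((marginal P (x i)).toReal * (marginal P (x (π i))).toReal) := by
    refine (pow_left_inj₀ (Finset.prod_nonneg fun _ _ => ENNReal.toReal_nonneg)
      (Finset.prod_nonneg fun _ _ => Real.sqrt_nonneg _) two_ne_zero).1 ?_
    rw [← Finset.prod_pow _ 2 fun i => Real.sqrt _]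
    simp only [Real.sq_sqrt (mul_nonneg ENNReal.toReal_nonneg ENNReal.toReal_nonneg)]
    rw [Finset.prod_mul_distrib, Equiv.prod_comp π fun i => (marginal P (x i)).toReal, sq]
  simp only [overlap, Finset.prod_mul_distrib, ← hp]
  simp only [bhattCoeff, Finset.prod_univ_sum, Fintype.piFinset_univ, Finset.mul_sum]
  rfl

lemma sum_prod_overlap_le [Fintype X] [Fintype Y] {M : ℕ} (P : PMF (X × Y))
    (π : Equiv.Perm (Fin M)) :
    ∑ x : Fin M → X, ∏ i, overlap P (x i) (x (π i)) ≤ frob (overlap P) ^ π.support.card := by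
  refine (sum_prod_perm_le (fun _ => overlap P) (fun _ => overlap_nonneg P) π).trans_eq ?_
  simp only [cycleWeight, trace_overlap]
  rw [Finset.prod_ite, Finset.prod_const_one, one_mul, Finset.prod_const]
  rfl

lemma pi_real_singleton [Fintype X] [Fintype Y] [MeasurableSpace X] [MeasurableSingletonClass X]
    [MeasurableSpace Y] [MeasurableSingletonClass Y] {L M : ℕ} (P : PMF (X × Y))
    (z : Fin M → Fin L → X × Y) :
    (Measure.pi fun _ : Fin M => Measure.pi fun _ : Fin L => P.toMeasure).real {z}
      = ∏ i, ∏ j, (P (z i j)).toReal := by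
  rw [Measure.real, Measure.pi_singleton, ENNReal.toReal_prod]
  refine Finset.prod_congr rfl fun i _ => ?_
  rw [Measure.pi_singleton, ENNReal.toReal_prod]
  refine Finset.prod_congr rfl fun j _ => ?_
  rw [PMF.toMeasure_apply_singleton _ _ (measurableSet_singleton _)]

/-- The probability that the ordering `π` of the fragments is at least as likely as the true one. -/
theorem measureReal_likelihood_le [Fintype X] [Fintype Y] [MeasurableSpace X]
    [MeasurableSingletonClass X] [MeasurableSpace Y] [MeasurableSingletonClass Y] {L M : ℕ}
    (P : PMF (X × Y)) (π : Equiv.Perm (Fin M)) :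
    (Measure.pi fun _ : Fin M => Measure.pi fun _ : Fin L => P.toMeasure).real
        {z | likelihood P (fun i j => (z i j).1) (fun i j => (z i j).2)
          ≤ likelihood P (fun i j => (z (π i) j).1) (fun i j => (z i j).2)}
      ≤ (frob (overlap P) ^ L) ^ π.support.card := by
  classical
  set S := {z : Fin M → Fin L → X × Y |
    likelihood P (fun i j => (z i j).1) (fun i j => (z i j).2)
      ≤ likelihood P (fun i j => (z (π i) j).1) (fun i j => (z i j).2)}
  have hS : S = ((Finset.univ.filter fun z => z ∈ S : Finset (Fin M → Fin L → X × Y)) : Set _) := by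
    ext z; simp
  rw [hS, ← sum_measureReal_singleton]
  let w : (Fin M → Fin L → X × Y) → ℝ := fun z => ∏ i, ∏ j, (marginal P (z i j).1).toReal *
    Real.sqrt (channel P (z i j).1 (z i j).2 * channel P (z (π i) j).1 (z i j).2)
  have hw0 : ∀ z, 0 ≤ w z := fun z => Finset.prod_nonneg fun _ _ => Finset.prod_nonneg fun _ _ =>
    mul_nonneg ENNReal.toReal_nonneg (Real.sqrt_nonneg _)
  calc ∑ z with z ∈ S,
        (Measure.pi fun _ : Fin M => Measure.pi fun _ : Fin L => P.toMeasure).real {z}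
      ≤ ∑ z with z ∈ S, w z := by
        refine Finset.sum_le_sum fun z hz => ?_
        have h := likelihood_le_prod_sqrt P (Finset.mem_filter.1 hz).2
        have h1 : ∀ i j, (P (z i j)).toReal
            = (marginal P (z i j).1).toReal * channel P (z i j).1 (z i j).2 := fun i j => by
          rw [marginal_mul_channel]
        rw [pi_real_singleton]
        simp only [h1, w, Finset.prod_mul_distrib]
        exact mul_le_mul_of_nonneg_left h (Finset.prod_nonneg fun _ _ =>
          Finset.prod_nonneg fun _ _ => ENNReal.toReal_nonneg)
    _ ≤ ∑ z, w z := Finset.sum_le_univ_sum_of_nonneg hw0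
    _ = (∑ x : Fin M → X, ∏ i, overlap P (x i) (x (π i))) ^ L := by
        -- Since `π` acts on fragments only, exchanging the fragment and position indices splits the
        -- sum into `L` identical factors.
        rw [← sum_prod_eq_sum_prod_overlap, ← Fin.prod_const, Finset.prod_univ_sum,
          Fintype.piFinset_univ, ← (Equiv.piComm fun _ _ => X × Y).sum_comp]
        refine Finset.sum_congr rfl fun z _ => ?_
        exact Finset.prod_comm
    _ ≤ _ := by
        rw [← pow_mul, mul_comm, pow_mul]
        exact pow_le_pow_left₀ (Finset.sum_nonneg fun _ _ => Finset.prod_nonneg fun _ _ =>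
          overlap_nonneg P _ _) (sum_prod_overlap_le P π) L

/-! ### The union bound and its exponent. -/

lemma fragDistortion_self {L : ℕ} {Δ : X → X → ℝ≥0} (hΔ : ∀ x, Δ x x = 0) (u : Fin L → X) :
    fragDistortion Δ u u = 0 := by
  simp [fragDistortion, hΔ]

lemma failureFraction_reorder_le {L M : ℕ} {Δ : X → X → ℝ≥0} (hΔ : ∀ x, Δ x x = 0)
    (x : Fin M → Fin L → X) (π : Equiv.Perm (Fin M)) :
    failureFraction Δ x (fun i => x (π i)) ≤ 1 / (M : ℝ) * π.support.card := by
  classical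
  unfold failureFraction
  refine mul_le_mul_of_nonneg_left ?_ (by positivity)
  rw [Nat.card_eq_fintype_card, Fintype.card_subtype]
  exact_mod_cast Finset.card_le_card fun i hi => by
    rw [Equiv.Perm.mem_support]
    intro h
    have h1 := (Finset.mem_filter.1 hi).2
    simp only [h, fragDistortion_self hΔ] at h1
    exact lt_irrefl _ h1

/-- The union bound over the orderings that move at least `k` fragments. -/
theorem failureProb_le_sum [Fintype X] [Fintype Y] [MeasurableSpace X]
    [MeasurableSingletonClass X] [MeasurableSpace Y] [MeasurableSingletonClass Y] {L M : ℕ}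
    (P : PMF (X × Y)) {Δ : X → X → ℝ≥0} (hΔ : ∀ x, Δ x x = 0)
    {rec' : Multiset (Fin L → X) → (Fin M → Fin L → Y) → (Fin M → Fin L → X)}
    (hrec : IsMLReconstruction P rec') {ξ : ℝ} {k : ℕ}
    (hk : ∀ n : ℕ, 2 ≤ n → ξ ≤ 1 / (M : ℝ) * n → k ≤ n) {q : ℝ}
    (hq : frob (overlap P) ^ L ≤ q) :
    failureProb P Δ rec' ξ ≤ ∑ f ∈ Finset.Ico k (M + 1), ((M : ℝ) * q) ^ f := by
  classical
  have hF : 0 ≤ frob (overlap P) ^ L := pow_nonneg (frob_nonneg _) L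
  refine le_trans ?_ (sum_perm_pow_card_support_le M k (hF.trans hq))
  unfold failureProb
  refine (measureReal_mono (s₂ := ⋃ π ∈ Finset.univ.filter
    (fun π : Equiv.Perm (Fin M) => k ≤ π.support.card), {z : Fin M → Fin L → X × Y |
      likelihood P (fun i j => (z i j).1) (fun i j => (z i j).2)
        ≤ likelihood P (fun i j => (z (π i) j).1) (fun i j => (z i j).2)})
      ?_ (measure_ne_top _ _)).trans
    ((measureReal_biUnion_finset_le _ _).trans (Finset.sum_le_sum fun π _ =>
      (measureReal_likelihood_le P π).trans (pow_le_pow_left₀ hF hq _)))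
  rintro z ⟨hpos, hξ⟩
  obtain ⟨⟨π, hπ⟩, hmax⟩ := hrec (fun i j => (z i j).1) (fun i j => (z i j).2)
  rw [← hπ] at hpos hξ hmax
  have hle := failureFraction_reorder_le hΔ (fun i j => (z i j).1) π
  simp only [Set.mem_iUnion, Finset.mem_filter, Finset.mem_univ, true_and]
  refine ⟨π, hk _ ?_ (hξ.trans hle), hmax _ ⟨1, rfl⟩⟩
  -- A failed fragment must have been moved, and a permutation cannot move exactly one point. Hence
  -- at least two are moved, the source of the exponent `2` at `ξ = 0`.
  have h0 : π.support.card ≠ 0 := fun h => by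
    rw [h, Nat.cast_zero, mul_zero] at hle
    exact absurd hpos hle.not_gt
  have h1 := π.card_support_ne_one
  omega

lemma failureProb_le_one {L M : ℕ} [MeasurableSpace X] [MeasurableSpace Y] (P : PMF (X × Y))
    (Δ : X → X → ℝ≥0)
    (rec' : Multiset (Fin L → X) → (Fin M → Fin L → Y) → (Fin M → Fin L → X)) (ξ : ℝ) :
    failureProb P Δ rec' ξ ≤ 1 :=
  measureReal_le_one

lemma frob_overlap_pow_le_rpow [Fintype X] [Fintype Y] [MeasurableSpace X]
    [MeasurableSingletonClass X] (P : PMF (X × Y)) {β : ℝ} {M L : ℕ} (hM : 1 ≤ M)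
    (hL : β * Real.log M ≤ L) :
    frob (overlap P) ^ L ≤ (M : ℝ) ^ (-(β * (psi2 P).toReal)) := by
  refine (pow_le_pow_left₀ (frob_nonneg _) (frob_overlap_le_exp_neg_psi2 P) L).trans ?_
  rw [← Real.exp_nat_mul, Real.rpow_def_of_pos (by exact_mod_cast hM)]
  refine Real.exp_le_exp.2 ?_
  have := mul_le_mul_of_nonneg_right hL (ENNReal.toReal_nonneg (a := psi2 P))
  linarith

/-- The value `a = 0` is excluded because its inverse is `⊤`; this is the convention `1/0 = ∞` in
the condition on `β`. -/
lemma one_lt_mul_toReal_of_inv_lt_ofReal {a : ℝ≥0∞} (ha : a ≠ ⊤) {β : ℝ}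
    (h : a⁻¹ < ENNReal.ofReal β) : 1 < β * a.toReal := by
  have ha0 : a ≠ 0 := by
    rintro rfl
    simp at h
  have hpos : 0 < a.toReal := ENNReal.toReal_pos ha0 ha
  have h1 := (ENNReal.lt_ofReal_iff_toReal_lt (ENNReal.inv_ne_top.2 ha0)).1 h
  rw [ENNReal.toReal_inv] at h1
  calc (1 : ℝ) = a.toReal⁻¹ * a.toReal := (inv_mul_cancel₀ hpos.ne').symm
    _ < β * a.toReal := mul_lt_mul_of_pos_right h1 hpos

end FragmentOrdering

theorem theorem1 {X Y : Type*} [Fintype X] [Fintype Y]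
    [MeasurableSpace X] [MeasurableSingletonClass X]
    [MeasurableSpace Y] [MeasurableSingletonClass Y]
    (P : PMF (X × Y)) :
    -- perfect reconstruction, `ξ = 0`
    (∃ C : ℝ, ∀ β : ℝ, (FragmentOrdering.psi2 P)⁻¹ < ENNReal.ofReal β →
      ∀ M L : ℕ, 1 ≤ M → β * Real.log M ≤ L →
      ∀ Δ : X → X → ℝ≥0, (∀ x, Δ x x = 0) →
      ∀ rec' : Multiset (Fin L → X) → (Fin M → Fin L → Y) → (Fin M → Fin L → X),
        FragmentOrdering.IsMLReconstruction P rec' →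
        FragmentOrdering.failureProb P Δ rec' 0 ≤
          C * (M : ℝ) ^ (2 * (1 - β * (FragmentOrdering.psi2 P).toReal))) ∧
    -- imperfect reconstruction, `ξ > 0`
    (∀ ξ : ℝ, 0 < ξ → ∃ c : ℝ, ∀ β : ℝ, (FragmentOrdering.psi2 P)⁻¹ < ENNReal.ofReal β →
      ∀ M L : ℕ, 1 ≤ M → β * Real.log M ≤ L →
      ∀ Δ : X → X → ℝ≥0, (∀ x, Δ x x = 0) →
      ∀ rec' : Multiset (Fin L → X) → (Fin M → Fin L → Y) → (Fin M → Fin L → X),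
        FragmentOrdering.IsMLReconstruction P rec' →
        FragmentOrdering.failureProb P Δ rec' ξ ≤
          Real.exp (-((M : ℝ) * Real.log M *
            (ξ * (β * (FragmentOrdering.psi2 P).toReal - 1 - c / M))))) := by
  classical
  constructor
  -- If `r ≤ 1/2`, the geometric tail from `f = 2` is at most `r² / (1 - r) ≤ 2 r²`. If `r > 1/2`,
  -- then `4 r² > 1` and the bound is trivial; this case dictates the constant.
  · refine ⟨4, fun β hβ M L hM hL Δ hΔ rec' hrec => ?_⟩
    have hM0 : (0 : ℝ) < M := by exact_mod_cast hM
    set r : ℝ := (M : ℝ) ^ (1 - β * (FragmentOrdering.psi2 P).toReal) with hr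
    have hr0 : 0 ≤ r := Real.rpow_nonneg hM0.le _
    have hr2 : (M : ℝ) ^ (2 * (1 - β * (FragmentOrdering.psi2 P).toReal)) = r ^ 2 := by
      rw [hr, mul_comm, Real.rpow_mul hM0.le, Real.rpow_two]
    have hMq : (M : ℝ) * (M : ℝ) ^ (-(β * (FragmentOrdering.psi2 P).toReal)) = r := by
      rw [hr, sub_eq_add_neg, Real.rpow_add hM0, Real.rpow_one]
    rw [hr2]
    rcases le_or_gt r (1 / 2) with h | h
    · have hb := FragmentOrdering.failureProb_le_sum P hΔ hrec (ξ := 0) (k := 2)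
        (fun n hn _ => hn) (FragmentOrdering.frob_overlap_pow_le_rpow P hM hL)
      rw [hMq] at hb
      refine hb.trans ((geom_sum_Ico_le_of_lt_one hr0 (by linarith)).trans ?_)
      rw [div_le_iff₀ (by linarith)]
      nlinarith [sq_nonneg r]
    · refine (FragmentOrdering.failureProb_le_one P Δ rec' 0).trans ?_
      nlinarith
  -- The number of terms in the sum is bounded by `M²`, and `M² = exp (M log M · ξ · c / M)` with `c
  -- = 2 / ξ`.
  · refine fun ξ hξ => ⟨2 / ξ, fun β hβ M L hM hL Δ hΔ rec' hrec => ?_⟩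
    have hM0 : (0 : ℝ) < M := by exact_mod_cast hM
    have hβψ := FragmentOrdering.one_lt_mul_toReal_of_inv_lt_ofReal
      (FragmentOrdering.psi2_ne_top P) hβ
    -- For `M = 1` the right-hand side is `exp 0 = 1`. The count `M + 1 ≤ M²` used below needs `M ≥
    -- 2`.
    rcases hM.eq_or_lt with rfl | hM2
    · simpa using FragmentOrdering.failureProb_le_one P Δ rec' ξ
    set a : ℝ := β * (FragmentOrdering.psi2 P).toReal with ha
    have hr0 : 0 < (M : ℝ) ^ (1 - a) := Real.rpow_pos_of_pos hM0 _
    have hr1 : (M : ℝ) ^ (1 - a) ≤ 1 :=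
      Real.rpow_le_one_of_one_le_of_nonpos (by exact_mod_cast hM) (by linarith)
    have hMq : (M : ℝ) * (M : ℝ) ^ (-a) = (M : ℝ) ^ (1 - a) := by
      rw [sub_eq_add_neg, Real.rpow_add hM0, Real.rpow_one]
    have hb := FragmentOrdering.failureProb_le_sum P hΔ hrec (ξ := ξ) (k := ⌈ξ * M⌉₊)
      (fun n _ hn => Nat.ceil_le.2 (by
        rw [one_div, inv_mul_eq_div, le_div_iff₀ hM0] at hn
        exact hn)) (FragmentOrdering.frob_overlap_pow_le_rpow P hM hL)
    rw [hMq] at hb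
    -- Since `β ψ₂ > 1` the base is at most one, so each term is bounded by the power with the real
    -- exponent `ξ M ≤ f`.
    have hterm : ∀ f ∈ Finset.Ico ⌈ξ * M⌉₊ (M + 1),
        ((M : ℝ) ^ (1 - a)) ^ f ≤ ((M : ℝ) ^ (1 - a)) ^ (ξ * M) := fun f hf => by
      rw [← Real.rpow_natCast]
      exact Real.rpow_le_rpow_of_exponent_ge hr0 hr1 (Nat.ceil_le.1 (Finset.mem_Ico.1 hf).1)
    have hcard : ((M + 1 - ⌈ξ * M⌉₊ : ℕ) : ℝ) ≤ (M : ℝ) ^ (2 : ℝ) := by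
      rw [Real.rpow_two]
      have h : M + 1 - ⌈ξ * M⌉₊ ≤ M ^ 2 := (Nat.sub_le _ _).trans (by nlinarith)
      exact_mod_cast h
    calc _ ≤ _ := hb
      _ ≤ ((M + 1 - ⌈ξ * M⌉₊ : ℕ) : ℝ) * ((M : ℝ) ^ (1 - a)) ^ (ξ * M) := by
        refine (Finset.sum_le_card_nsmul _ _ _ hterm).trans_eq ?_
        rw [Nat.card_Ico, nsmul_eq_mul]
      _ ≤ (M : ℝ) ^ (2 : ℝ) * ((M : ℝ) ^ (1 - a)) ^ (ξ * M) :=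
        mul_le_mul_of_nonneg_right hcard (Real.rpow_nonneg hr0.le _)
      _ = Real.exp (-((M : ℝ) * Real.log M * (ξ * (a - 1 - 2 / ξ / M)))) := by
        rw [← Real.rpow_mul hM0.le, ← Real.rpow_add hM0, Real.rpow_def_of_pos hM0]
        congr 1
        field_simp
        ring
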